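/- Let $a,b\in\mathbb{C}$ with $ab\neq 0$, let $f(z)=ae^{z}+be^{-z}$, and let $I=\{z\in\mathbb{C} : |f^{\circ n}(z)|\to\infty \text{ as } n\to\infty\}$ be the escaping set of $f$. Then $I$ is Lebesgue measurable (indeed Borel) and has infinite two-dimensional Lebesgue measure. Moreover, for all real $\alpha,\beta$ and the horizontal strip $S=\{z\in\mathbb{C} : \alpha\le \operatorname{Im} z\le\beta\}$, the set $S\setminus I$ has finite two-dimensional Lebesgue measure. In addition (Milnor's conjecture for the sine map): the set $B=\{z\in\mathbb{C} : \sin^{\circ n}(z)\to 0 \text{ as } n\to\infty\}$ of points converging to the fixed point $0$ under iteration of $\sin$ is Borel, and for all real $\alpha,\beta$ its intersection with the vertical strip $\{z\in\mathbb{C} : \alpha\le\operatorname{Re} z\le\beta\}$ has finite two-dimensional Lebesgue measure. -/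

import Mathlib

open Filter Topology MeasureTheory

/-- The escaping set `I` of a self-map of the plane: the points `z` with `|f^[n] z| → ∞`. -/
def escapingSet (f : ℂ → ℂ) : Set ℂ :=
  {z | Tendsto (fun n : ℕ => ‖f^[n] z‖) atTop atTop}

/-- The points whose orbit under `f` converges to `p`. -/
def convergenceSet (f : ℂ → ℂ) (p : ℂ) : Set ℂ :=
  {z | Tendsto (fun n : ℕ => f^[n] z) atTop (𝓝 p)}

/-- The closed horizontal strip `α ≤ Im z ≤ β`. -/
def horizontalStrip (α β : ℝ) : Set ℂ := {z | α ≤ z.im ∧ z.im ≤ β}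

/-- The closed vertical strip `α ≤ Re z ≤ β`. -/
def verticalStrip (α β : ℝ) : Set ℂ := {z | α ≤ z.re ∧ z.re ≤ β}

/-- The map `z ↦ a e^z + b e^{-z}`. -/
noncomputable def expSumMap (a b : ℂ) (z : ℂ) : ℂ :=
  a * Complex.exp z + b * Complex.exp (-z)

/-! `f` is `2πi`-periodic, and where `|Re z| ≥ R` one exponential dominates: there `|f| ≥ T`, `|f'|
≥ |f|/2`, and `f` is injective on each half of a period strip. By change of variables the pullback
of a periodic set `E` to such a half has area at most the integral of `4/|w|²` over `E ∩ {|w| ≥ T}`.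
Slicing by period strips bounds this by a quarter of the area of `E` modulo `2πi`, for large `T`.
The two halves together give a factor `1/2` (`exists_volume_preimage_expSumMap_le`).

So the points that stay in `|Re z| ≥ R` for `n` steps and then land in `|Re z| < M` have area
`O(2⁻ⁿ)` modulo `2πi`. A non-escaping point either enters `|Re z| < R`, which costs a finite
geometric sum, or returns infinitely often to some `|Re z| < M`, which is a null event by
Borel–Cantelli. Period strips have infinite area, hence so does the escaping set. Rotation by `i`
turns `sin` into `sinh`. -/

/-! ### Period strips and periodic sets -/

/-- The half-open horizontal strip of height `2π` centred at the line `Im z = 2πk`. -/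
def periodStrip (k : ℤ) : Set ℂ :=
  {z | 2 * Real.pi * k - Real.pi < z.im ∧ z.im ≤ 2 * Real.pi * k + Real.pi}

lemma measurableSet_periodStrip (k : ℤ) : MeasurableSet (periodStrip k) :=
  (measurableSet_lt measurable_const Complex.measurable_im).inter
    (measurableSet_le Complex.measurable_im measurable_const)

lemma exists_mem_periodStrip (z : ℂ) : ∃ k : ℤ, z ∈ periodStrip k := by
  have hpi := Real.pi_pos
  refine ⟨⌈(z.im - Real.pi) / (2 * Real.pi)⌉, ?_, ?_⟩
  · have := Int.ceil_lt_add_one ((z.im - Real.pi) / (2 * Real.pi))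
    rw [← sub_lt_iff_lt_add, lt_div_iff₀ (by positivity)] at this
    linarith
  · have := Int.le_ceil ((z.im - Real.pi) / (2 * Real.pi))
    rw [div_le_iff₀ (by positivity)] at this
    linarith

lemma iUnion_periodStrip : ⋃ k, periodStrip k = Set.univ :=
  Set.eq_univ_of_forall fun z => Set.mem_iUnion.2 (exists_mem_periodStrip z)

/-- Invariance of a set under the translation by `2πi`. -/
def IsPeriodicSet (E : Set ℂ) : Prop :=
  ∀ (k : ℤ) (z : ℂ), z + k * (2 * Real.pi * Complex.I) ∈ E ↔ z ∈ E

lemma IsPeriodicSet.volume_inter_periodStrip {E : Set ℂ} (hE : IsPeriodicSet E) (k : ℤ) :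
    volume (E ∩ periodStrip k) = volume (E ∩ periodStrip 0) := by
  rw [← measure_preimage_add_right volume ((k : ℂ) * (2 * Real.pi * Complex.I))
    (E ∩ periodStrip k)]
  congr 1
  ext z
  simp only [Set.mem_preimage, Set.mem_inter_iff, hE k z]
  refine and_congr_right fun _ => ?_
  simp only [periodStrip, Set.mem_ofPred_eq, Complex.add_im, Complex.mul_im, Complex.intCast_re,
    Complex.intCast_im, Complex.mul_re, Complex.I_re, Complex.I_im, Complex.ofReal_re,
    Complex.ofReal_im, Complex.re_ofNat, Complex.im_ofNat, Int.cast_zero]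
  constructor <;> rintro ⟨h1, h2⟩ <;> constructor <;> linarith

/-- Dominated convergence as `T → ∞`. The bound is `1/4` because the left and right half-strips each
contribute once to the factor `1/2`. -/
lemma exists_tsum_inv_sq_add_sq_le :
    ∃ T : ℝ, 0 < T ∧ ∑' k : ℤ, ENNReal.ofReal (8 / (T ^ 2 + (k : ℝ) ^ 2)) ≤ 1 / 4 := by
  have hs : Summable fun k : ℤ => 8 / (1 + (k : ℝ) ^ 2) := by
    refine Summable.of_norm_bounded_eventually
      (g := fun k : ℤ => 8 * (1 / (k : ℝ) ^ 2)) ?_ ?_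
    · exact (Real.summable_one_div_int_pow.2 one_lt_two).mul_left 8
    · filter_upwards [(Set.finite_singleton (0 : ℤ)).compl_mem_cofinite] with k hk
      have hk' : (k : ℝ) ≠ 0 := by exact_mod_cast hk
      have : 0 < (k : ℝ) ^ 2 := by positivity
      rw [Real.norm_of_nonneg (by positivity), ← mul_div_assoc, mul_one]
      gcongr
      linarith
  have hlim : Tendsto (fun T : ℝ => ∑' k : ℤ, 8 / (T ^ 2 + (k : ℝ) ^ 2)) atTop
      (𝓝 (∑' _ : ℤ, (0 : ℝ))) := by
    refine tendsto_tsum_of_dominated_convergence hs (fun k => ?_) ?_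
    · refine Tendsto.div_atTop tendsto_const_nhds ?_
      exact tendsto_atTop_add_const_right _ _ (tendsto_pow_atTop two_ne_zero)
    · filter_upwards [eventually_ge_atTop 1] with T hT k
      rw [Real.norm_of_nonneg (by positivity)]
      gcongr
      nlinarith
  rw [tsum_zero] at hlim
  obtain ⟨T, hT, hT1⟩ := ((hlim.eventually (gt_mem_nhds (show (0 : ℝ) < 1 / 4 by norm_num))).and
    (eventually_ge_atTop 1)).exists
  refine ⟨T, by linarith, ?_⟩
  rw [← ENNReal.ofReal_tsum_of_nonneg (fun k => by positivity)]
  · refine (ENNReal.ofReal_le_ofReal hT.le).trans (le_of_eq ?_)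
    rw [ENNReal.ofReal_div_of_pos (by norm_num)]
    simp
  · refine hs.of_nonneg_of_le (fun k => by positivity) fun k => ?_
    gcongr
    nlinarith

lemma abs_le_abs_im_of_mem_periodStrip {k : ℤ} {z : ℂ} (hz : z ∈ periodStrip k) :
    |(k : ℝ)| ≤ |z.im| := by
  have hpi := Real.pi_gt_three
  obtain ⟨h1, h2⟩ := hz
  rcases lt_trichotomy k 0 with hk | rfl | hk
  · have hk' : (k : ℝ) ≤ -1 := by exact_mod_cast Int.le_sub_one_of_lt hk
    rw [abs_of_neg (by linarith)]
    refine le_trans ?_ (neg_le_abs _)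
    nlinarith
  · simp
  · have hk' : (1 : ℝ) ≤ k := by exact_mod_cast hk
    rw [abs_of_pos (by linarith)]
    refine le_trans ?_ (le_abs_self _)
    nlinarith

/-- On the `k`-th strip `‖w‖ ≥ max T |k|`, so `T² + k² ≤ 2‖w‖²`. -/
lemma IsPeriodicSet.setLIntegral_inv_sq_le {E : Set ℂ} (hE : IsPeriodicSet E) {T : ℝ} (hT : 0 < T) :
    ∫⁻ w in E ∩ {w | T ≤ ‖w‖}, ENNReal.ofReal (4 / ‖w‖ ^ 2) ≤
      (∑' k : ℤ, ENNReal.ofReal (8 / (T ^ 2 + (k : ℝ) ^ 2))) * volume (E ∩ periodStrip 0) := by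
  have hcover : E ∩ {w : ℂ | T ≤ ‖w‖} ⊆ ⋃ k, (E ∩ {w : ℂ | T ≤ ‖w‖}) ∩ periodStrip k := by
    rw [← Set.inter_iUnion, iUnion_periodStrip, Set.inter_univ]
  calc ∫⁻ w in E ∩ {w | T ≤ ‖w‖}, ENNReal.ofReal (4 / ‖w‖ ^ 2)
      ≤ ∫⁻ w in ⋃ k, (E ∩ {w : ℂ | T ≤ ‖w‖}) ∩ periodStrip k, ENNReal.ofReal (4 / ‖w‖ ^ 2) :=
        lintegral_mono_set hcover
    _ ≤ ∑' k, ∫⁻ w in (E ∩ {w : ℂ | T ≤ ‖w‖}) ∩ periodStrip k, ENNReal.ofReal (4 / ‖w‖ ^ 2) :=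
        lintegral_iUnion_le _ _
    _ ≤ ∑' k : ℤ, ENNReal.ofReal (8 / (T ^ 2 + (k : ℝ) ^ 2)) * volume (E ∩ periodStrip 0) := by
        refine ENNReal.tsum_le_tsum fun k => ?_
        calc _ ≤ ∫⁻ _ in (E ∩ {w : ℂ | T ≤ ‖w‖}) ∩ periodStrip k,
              ENNReal.ofReal (8 / (T ^ 2 + (k : ℝ) ^ 2)) := by
                refine setLIntegral_mono measurable_const fun w hw => ?_
                refine ENNReal.ofReal_le_ofReal ?_
                have hw1 : T ≤ ‖w‖ := hw.1.2
                have hw2 : (k : ℝ) ^ 2 ≤ ‖w‖ ^ 2 :=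
                  sq_le_sq' (by linarith [neg_abs_le (k : ℝ), Complex.abs_im_le_norm w,
                    abs_le_abs_im_of_mem_periodStrip hw.2]) ((le_abs_self _).trans
                    ((abs_le_abs_im_of_mem_periodStrip hw.2).trans (Complex.abs_im_le_norm w)))
                have hw3 : T ^ 2 ≤ ‖w‖ ^ 2 := by gcongr
                have hT2 : 0 < T ^ 2 := by positivity
                rw [div_le_div_iff₀ (by linarith) (by positivity)]
                linarith
          _ = ENNReal.ofReal (8 / (T ^ 2 + (k : ℝ) ^ 2)) *
              volume ((E ∩ {w : ℂ | T ≤ ‖w‖}) ∩ periodStrip k) := setLIntegral_const _ _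
          _ ≤ _ := by
              rw [← hE.volume_inter_periodStrip k]
              gcongr
              exact Set.inter_subset_left
    _ = _ := ENNReal.tsum_mul_right

/-! ### Area of preimages -/

lemma abs_det_smul_one (c : ℂ) : |(c • (1 : ℂ →L[ℝ] ℂ)).det| = ‖c‖ ^ 2 := by
  have : (c • (1 : ℂ →L[ℝ] ℂ)).det = Algebra.norm ℝ c := by
    rw [Algebra.norm_apply]
    rfl
  rw [this, Algebra.norm_complex_apply, Complex.normSq_eq_norm_sq, abs_of_nonneg (by positivity)]

/-- Area estimate for preimages under an injective holomorphic map with `|f'| ≥ |f| / 2`. -/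
lemma volume_inter_preimage_le_setLIntegral {f f' : ℂ → ℂ} {P E : Set ℂ} {T : ℝ} (hT : 0 < T)
    (hf : ∀ z, HasDerivAt f (f' z) z) (hP : MeasurableSet P) (hE : MeasurableSet E)
    (hinj : Set.InjOn f P) (hfT : ∀ z ∈ P, T ≤ ‖f z‖) (hff' : ∀ z ∈ P, ‖f z‖ ≤ 2 * ‖f' z‖) :
    volume (P ∩ f ⁻¹' E) ≤ ∫⁻ w in E ∩ {w | T ≤ ‖w‖}, ENNReal.ofReal (4 / ‖w‖ ^ 2) := by
  have hfc : Continuous f := continuous_iff_continuousAt.2 fun z => (hf z).continuousAt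
  have hm : MeasurableSet (P ∩ f ⁻¹' E) := hP.inter (hfc.measurable hE)
  calc volume (P ∩ f ⁻¹' E) = ∫⁻ _ in P ∩ f ⁻¹' E, 1 := by simp
    _ ≤ ∫⁻ z in P ∩ f ⁻¹' E, ENNReal.ofReal |(f' z • (1 : ℂ →L[ℝ] ℂ)).det| *
        ENNReal.ofReal (4 / ‖f z‖ ^ 2) := by
      refine setLIntegral_mono' hm fun z hz => ?_
      rw [abs_det_smul_one, ← ENNReal.ofReal_mul (by positivity), ← ENNReal.ofReal_one]
      refine ENNReal.ofReal_le_ofReal ?_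
      have h1 : 0 < ‖f z‖ := hT.trans_le (hfT z hz.1)
      have h2 := hff' z hz.1
      rw [← mul_div_assoc, le_div_iff₀ (by positivity), one_mul]
      calc ‖f z‖ ^ 2 ≤ (2 * ‖f' z‖) ^ 2 := by gcongr
        _ = ‖f' z‖ ^ 2 * 4 := by ring
    _ = ∫⁻ w in f '' (P ∩ f ⁻¹' E), ENNReal.ofReal (4 / ‖w‖ ^ 2) :=
      (lintegral_image_eq_lintegral_abs_det_fderiv_mul volume hm
        (fun z _ => (hf z).complexToReal_fderiv.hasFDerivWithinAt)
        (hinj.mono Set.inter_subset_left) fun w => ENNReal.ofReal (4 / ‖w‖ ^ 2)).symm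
    _ ≤ _ := by
      refine lintegral_mono_set ?_
      rintro _ ⟨z, hz, rfl⟩
      exact ⟨hz.2, hfT z hz.1⟩

/-! ### Orbits outside a central strip -/

/-- The points that spend the times `0, …, n - 1` in `A` and are in `E` at time `n`. -/
def passageSet (f : ℂ → ℂ) (A E : Set ℂ) (n : ℕ) : Set ℂ :=
  {z | (∀ i < n, f^[i] z ∈ A) ∧ f^[n] z ∈ E}

lemma passageSet_zero (f : ℂ → ℂ) (A E : Set ℂ) : passageSet f A E 0 = E := by
  ext z
  simp [passageSet]

lemma passageSet_succ (f : ℂ → ℂ) (A E : Set ℂ) (n : ℕ) :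
    passageSet f A E (n + 1) = A ∩ f ⁻¹' passageSet f A E n := by
  ext z
  simp only [passageSet, Set.mem_ofPred_eq, Set.mem_inter_iff, Set.mem_preimage,
    Function.iterate_succ_apply, Nat.forall_lt_succ_left, Function.iterate_zero_apply, and_assoc]

/-- The points with `|Re z| < M`. -/
def centralStrip (M : ℝ) : Set ℂ := {z | |z.re| < M}

lemma measurableSet_centralStrip (M : ℝ) : MeasurableSet (centralStrip M) :=
  measurableSet_lt Complex.measurable_re.abs measurable_const

lemma isPeriodicSet_centralStrip (M : ℝ) : IsPeriodicSet (centralStrip M) := by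
  intro k z
  simp [centralStrip]

lemma IsPeriodicSet.compl {E : Set ℂ} (hE : IsPeriodicSet E) : IsPeriodicSet Eᶜ :=
  fun k z => not_congr (hE k z)

lemma IsPeriodicSet.inter {E F : Set ℂ} (hE : IsPeriodicSet E) (hF : IsPeriodicSet F) :
    IsPeriodicSet (E ∩ F) :=
  fun k z => and_congr (hE k z) (hF k z)

lemma volume_centralStrip_inter_lt_top (M : ℝ) :
    volume (centralStrip M ∩ periodStrip 0) < ⊤ := by
  refine Bornology.IsBounded.measure_lt_top ?_
  refine (Metric.isBounded_closedBall (x := (0 : ℂ)) (r := M + Real.pi)).subset ?_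
  rintro z ⟨h1, h2, h3⟩
  rw [mem_closedBall_zero_iff]
  have h1' : |z.re| < M := h1
  have h4 : |z.im| ≤ Real.pi := abs_le.2 ⟨by simp at h2; linarith, by simpa using h3⟩
  exact (Complex.norm_le_abs_re_add_abs_im z).trans (by linarith)

/-- If there is no first visit to `centralStrip R`, the whole orbit stays outside it; eventually
avoiding every `centralStrip M` then forces `|Re|` to infinity. -/
lemma exists_passageSet_of_notMem_escapingSet {f : ℂ → ℂ} {R : ℝ} {z : ℂ}
    (hz : z ∉ escapingSet f) :
    (∃ n, z ∈ passageSet f (centralStrip R)ᶜ (centralStrip R) n) ∨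
      ∃ M : ℕ, ¬ ∀ᶠ n in atTop, z ∉ passageSet f (centralStrip R)ᶜ (centralStrip M) n := by
  by_contra! h
  obtain ⟨h1, h2⟩ := h
  have hA : ∀ n, f^[n] z ∈ (centralStrip R)ᶜ := by
    intro n
    induction n using Nat.strong_induction_on with
    | _ n ih => exact fun hn => h1 n ⟨ih, hn⟩
  refine hz (tendsto_atTop.2 fun B => ?_)
  obtain ⟨M, hM⟩ := exists_nat_ge B
  filter_upwards [h2 M] with n hn
  have : ¬ |(f^[n] z).re| < M := fun hlt => hn ⟨fun i _ => hA i, hlt⟩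
  exact hM.trans ((not_lt.1 this).trans (Complex.abs_re_le_norm _))

section Contraction

variable {f : ℂ → ℂ} {R : ℝ}

lemma measurableSet_passageSet (hf : Measurable f) (M : ℝ) (n : ℕ) :
    MeasurableSet (passageSet f (centralStrip R)ᶜ (centralStrip M) n) := by
  induction n with
  | zero => simpa [passageSet_zero] using measurableSet_centralStrip M
  | succ n ih =>
    rw [passageSet_succ]
    exact (measurableSet_centralStrip R).compl.inter (hf ih)

lemma isPeriodicSet_passageSet (hper : ∀ E, IsPeriodicSet (f ⁻¹' E)) (M : ℝ) (n : ℕ) :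
    IsPeriodicSet (passageSet f (centralStrip R)ᶜ (centralStrip M) n) := by
  induction n with
  | zero => simpa [passageSet_zero] using isPeriodicSet_centralStrip M
  | succ n ih =>
    rw [passageSet_succ]
    exact (isPeriodicSet_centralStrip R).compl.inter (hper _)

lemma tsum_volume_passageSet_lt_top (hf : Measurable f) (hper : ∀ E, IsPeriodicSet (f ⁻¹' E))
    (hcontr : ∀ E, IsPeriodicSet E → MeasurableSet E →
      volume (((centralStrip R)ᶜ ∩ f ⁻¹' E) ∩ periodStrip 0) ≤
        2⁻¹ * volume (E ∩ periodStrip 0)) (M : ℝ) :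
    ∑' n, volume (passageSet f (centralStrip R)ᶜ (centralStrip M) n ∩ periodStrip 0) < ⊤ := by
  have hn : ∀ n, volume (passageSet f (centralStrip R)ᶜ (centralStrip M) n ∩ periodStrip 0) ≤
      2⁻¹ ^ n * volume (centralStrip M ∩ periodStrip 0) := by
    intro n
    induction n with
    | zero => simp [passageSet_zero]
    | succ n ih =>
      rw [passageSet_succ, pow_succ', mul_assoc]
      exact (hcontr _ (isPeriodicSet_passageSet hper M n)
        (measurableSet_passageSet hf M n)).trans (by gcongr)
  refine (ENNReal.tsum_le_tsum hn).trans_lt ?_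
  rw [ENNReal.tsum_mul_right, ENNReal.tsum_geometric, ENNReal.one_sub_inv_two, inv_inv]
  exact ENNReal.mul_lt_top (by simp) (volume_centralStrip_inter_lt_top M)

lemma volume_compl_escapingSet_inter_periodStrip_lt_top (hf : Measurable f)
    (hper : ∀ E, IsPeriodicSet (f ⁻¹' E))
    (hcontr : ∀ E, IsPeriodicSet E → MeasurableSet E →
      volume (((centralStrip R)ᶜ ∩ f ⁻¹' E) ∩ periodStrip 0) ≤
        2⁻¹ * volume (E ∩ periodStrip 0)) :
    volume ((escapingSet f)ᶜ ∩ periodStrip 0) < ⊤ := by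
  -- Borel–Cantelli, from the summable passage areas.
  have hnull : ∀ M : ℕ, volume {z | ¬ ∀ᶠ n in atTop,
      z ∉ passageSet f (centralStrip R)ᶜ (centralStrip M) n ∩ periodStrip 0} = 0 := fun M =>
    ae_iff.1 (ae_eventually_notMem (tsum_volume_passageSet_lt_top hf hper hcontr M).ne)
  have hsub : (escapingSet f)ᶜ ∩ periodStrip 0 ⊆
      (⋃ n, passageSet f (centralStrip R)ᶜ (centralStrip R) n ∩ periodStrip 0) ∪
      ⋃ M : ℕ, {z | ¬ ∀ᶠ n in atTop,
        z ∉ passageSet f (centralStrip R)ᶜ (centralStrip M) n ∩ periodStrip 0} := by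
    rintro z ⟨hz, hzS⟩
    rcases exists_passageSet_of_notMem_escapingSet (R := R) hz with ⟨n, hn⟩ | ⟨M, hM⟩
    · exact Or.inl (Set.mem_iUnion.2 ⟨n, hn, hzS⟩)
    · refine Or.inr (Set.mem_iUnion.2 ⟨M, fun h => hM (h.mono fun n hn hmem => hn ⟨hmem, hzS⟩)⟩)
  refine (measure_mono hsub).trans_lt ((measure_union_le _ _).trans_lt ?_)
  rw [measure_iUnion_null hnull, add_zero]
  exact (measure_iUnion_le _).trans_lt (tsum_volume_passageSet_lt_top hf hper hcontr R)

end Contraction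

/-- The escaping set equals its own preimage under `f`, and preimages are periodic. -/
lemma isPeriodicSet_compl_escapingSet {f : ℂ → ℂ} (hper : ∀ E, IsPeriodicSet (f ⁻¹' E)) :
    IsPeriodicSet (escapingSet f)ᶜ := by
  refine IsPeriodicSet.compl ?_
  have : escapingSet f = f ⁻¹' escapingSet f := by
    ext z
    simp only [escapingSet, Set.mem_ofPred_eq, Set.mem_preimage, ← Function.iterate_succ_apply]
    exact (tendsto_add_atTop_iff_nat (f := fun n => ‖f^[n] z‖) 1).symm
  rw [this]
  exact hper _

lemma IsPeriodicSet.volume_inter_horizontalStrip_lt_top {E : Set ℂ} (hE : IsPeriodicSet E)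
    (h0 : volume (E ∩ periodStrip 0) < ⊤) (α β : ℝ) :
    volume (horizontalStrip α β ∩ E) < ⊤ := by
  have hpi := Real.pi_gt_three
  have hsub : horizontalStrip α β ∩ E ⊆
      ⋃ k ∈ Finset.Icc (-⌈|α| + |β|⌉) ⌈|α| + |β|⌉, E ∩ periodStrip k := by
    rintro z ⟨⟨hα, hβ⟩, hz⟩
    obtain ⟨k, hk⟩ := exists_mem_periodStrip z
    have h1 := abs_le_abs_im_of_mem_periodStrip hk
    have h2 : |z.im| ≤ |α| + |β| := abs_le.2 ⟨by linarith [neg_abs_le α, abs_nonneg β],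
      by linarith [le_abs_self β, abs_nonneg α]⟩
    have h3 : |(k : ℝ)| ≤ ⌈|α| + |β|⌉ := h1.trans (h2.trans (Int.le_ceil _))
    rw [← Int.cast_abs] at h3
    exact Set.mem_biUnion (Finset.mem_coe.2 (Finset.mem_Icc.2 (abs_le.1 (by exact_mod_cast h3))))
      ⟨hz, hk⟩
  refine (measure_mono hsub).trans_lt ((measure_biUnion_finset_le _ _).trans_lt ?_)
  simp only [hE.volume_inter_periodStrip]
  exact ENNReal.sum_lt_top.2 fun _ _ => h0

lemma volume_periodStrip_zero : volume (periodStrip 0) = ⊤ := by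
  rw [← Complex.volume_preserving_equiv_real_prod.symm.measure_preimage_equiv]
  have : Complex.measurableEquivRealProd.symm ⁻¹' periodStrip 0 =
      Set.univ ×ˢ Set.Ioc (-Real.pi) Real.pi := by
    ext ⟨x, y⟩
    simp [periodStrip, Complex.measurableEquivRealProd]
  rw [this, Measure.volume_eq_prod, Measure.prod_prod, Real.volume_univ, Real.volume_Ioc]
  refine ENNReal.top_mul ?_
  simp [Real.pi_pos]

/-! ### The map `a e^z + b e^{-z}` -/

lemma continuous_expSumMap (a b : ℂ) : Continuous (expSumMap a b) := by
  unfold expSumMap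
  fun_prop

lemma hasDerivAt_expSumMap (a b z : ℂ) :
    HasDerivAt (expSumMap a b) (a * Complex.exp z - b * Complex.exp (-z)) z := by
  have h := ((Complex.hasDerivAt_exp z).const_mul a).add
    ((((hasDerivAt_id z).neg).cexp).const_mul b)
  refine h.congr_deriv ?_
  simp
  ring

lemma expSumMap_neg (a b z : ℂ) : expSumMap a b (-z) = expSumMap b a z := by
  simp [expSumMap, add_comm]

lemma isPeriodicSet_preimage_expSumMap (a b : ℂ) (E : Set ℂ) :
    IsPeriodicSet (expSumMap a b ⁻¹' E) := by
  intro k z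
  have h1 : Complex.exp (z + k * (2 * Real.pi * Complex.I)) = Complex.exp z :=
    Complex.exp_periodic.int_mul k z
  simp only [Set.mem_preimage, expSumMap, Complex.exp_neg, h1]

/-- `f z = f w` factors as `(e^z - e^w)(a e^z e^w - b) = 0`. If the second factor vanished, the
dominant term at each point would have the size of the minor term at the other, and adding the two
domination inequalities gives a contradiction. -/
lemma injOn_expSumMap {a b : ℂ} (hb : b ≠ 0) {Q : Set ℂ} (hQ : Set.InjOn Complex.exp Q)
    (h : ∀ z ∈ Q, 3 * (‖b‖ * Real.exp (-z.re)) ≤ ‖a‖ * Real.exp z.re) :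
    Set.InjOn (expSumMap a b) Q := by
  intro z hz w hw hzw
  refine hQ hz hw ?_
  have hu := Complex.exp_ne_zero z
  have hv := Complex.exp_ne_zero w
  simp only [expSumMap, Complex.exp_neg] at hzw
  have hprod : (Complex.exp z - Complex.exp w) * (a * Complex.exp z * Complex.exp w - b) = 0 := by
    field_simp at hzw
    linear_combination hzw
  rcases mul_eq_zero.1 hprod with h0 | h0
  · exact sub_eq_zero.1 h0
  · exfalso
    have hn : ‖a‖ * Real.exp z.re * Real.exp w.re = ‖b‖ := by
      rw [← Complex.norm_exp, ← Complex.norm_exp, ← norm_mul, ← norm_mul, sub_eq_zero.1 h0]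
    have hbpos : 0 < ‖b‖ := norm_pos_iff.2 hb
    have hz' := h z hz
    have hw' := h w hw
    have ez : Real.exp z.re * Real.exp (-z.re) = 1 := by rw [← Real.exp_add]; simp
    have ew : Real.exp w.re * Real.exp (-w.re) = 1 := by rw [← Real.exp_add]; simp
    have hz2 : ‖a‖ * Real.exp z.re = ‖b‖ * Real.exp (-w.re) := by
      rw [← hn, mul_assoc _ (Real.exp w.re), ew, mul_one]
    have hw2 : ‖a‖ * Real.exp w.re = ‖b‖ * Real.exp (-z.re) := by
      rw [← hn, mul_right_comm, mul_assoc _ (Real.exp z.re), ez, mul_one]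
    have p1 : 0 < ‖b‖ * Real.exp (-z.re) := by positivity
    have p2 : 0 < ‖b‖ * Real.exp (-w.re) := by positivity
    linarith

/-- With dominant term of size `u` and the other at most `u/3`: `2u/3 ≤ |f| ≤ 4u/3` and `|f'| ≥
2u/3`. -/
lemma norm_expSumMap_bounds {a b z : ℂ} {T : ℝ} (hT : 3 * T ≤ 2 * (‖a‖ * Real.exp z.re))
    (h : 3 * (‖b‖ * Real.exp (-z.re)) ≤ ‖a‖ * Real.exp z.re) :
    T ≤ ‖expSumMap a b z‖ ∧
      ‖expSumMap a b z‖ ≤ 2 * ‖a * Complex.exp z - b * Complex.exp (-z)‖ := by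
  have hu : ‖a * Complex.exp z‖ = ‖a‖ * Real.exp z.re := by rw [norm_mul, Complex.norm_exp]
  have hv : ‖b * Complex.exp (-z)‖ = ‖b‖ * Real.exp (-z.re) := by
    rw [norm_mul, Complex.norm_exp, Complex.neg_re]
  have h1 := norm_sub_norm_le (a * Complex.exp z) (b * Complex.exp (-z))
  have h2 := norm_sub_norm_le (a * Complex.exp z) (-(b * Complex.exp (-z)))
  have h3 := norm_add_le (a * Complex.exp z) (b * Complex.exp (-z))
  rw [norm_neg, sub_neg_eq_add] at h2
  unfold expSumMap
  constructor <;> linarith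

lemma eventually_dominant_term {a : ℂ} (ha : a ≠ 0) (b : ℂ) (T : ℝ) :
    ∀ᶠ x : ℝ in atTop, 3 * T ≤ 2 * (‖a‖ * Real.exp x) ∧
      3 * (‖b‖ * Real.exp (-x)) ≤ ‖a‖ * Real.exp x := by
  have hlim : Tendsto (fun x => ‖a‖ * Real.exp x) atTop atTop :=
    Real.tendsto_exp_atTop.const_mul_atTop (norm_pos_iff.2 ha)
  filter_upwards [hlim.eventually_ge_atTop (3 * T / 2), hlim.eventually_ge_atTop (3 * ‖b‖),
    eventually_ge_atTop 0] with x h1 h2 h3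
  have h4 : Real.exp (-x) ≤ 1 := Real.exp_le_one_iff.2 (by linarith)
  have h5 : ‖b‖ * Real.exp (-x) ≤ ‖b‖ := mul_le_of_le_one_right (norm_nonneg b) h4
  constructor <;> linarith

lemma injOn_exp_periodStrip_zero : Set.InjOn Complex.exp (periodStrip 0) := by
  rintro z ⟨hz1, hz2⟩ w ⟨hw1, hw2⟩ h
  simp only [Int.cast_zero, mul_zero, zero_sub, zero_add] at hz1 hz2 hw1 hw2
  exact Complex.exp_inj_of_neg_pi_lt_of_le_pi hz1 hz2 hw1 hw2 h

/-- Pulling a periodic set back to `|Re z| ≥ R` halves its area modulo `2πi`. -/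
lemma exists_volume_preimage_expSumMap_le {a b : ℂ} (ha : a ≠ 0) (hb : b ≠ 0) :
    ∃ R : ℝ, ∀ E, IsPeriodicSet E → MeasurableSet E →
      volume (((centralStrip R)ᶜ ∩ expSumMap a b ⁻¹' E) ∩ periodStrip 0) ≤
        2⁻¹ * volume (E ∩ periodStrip 0) := by
  obtain ⟨T, hT, hsum⟩ := exists_tsum_inv_sq_add_sq_le
  obtain ⟨R, hR⟩ := eventually_atTop.1
    ((eventually_dominant_term ha b T).and (eventually_dominant_term hb a T))
  refine ⟨R, fun E hE hEm => ?_⟩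
  have hright : volume ((periodStrip 0 ∩ {z | R ≤ z.re}) ∩ expSumMap a b ⁻¹' E) ≤
      1 / 4 * volume (E ∩ periodStrip 0) := by
    refine ((volume_inter_preimage_le_setLIntegral hT (hasDerivAt_expSumMap a b)
      ((measurableSet_periodStrip 0).inter (measurableSet_le measurable_const
        Complex.measurable_re)) hEm ?_ ?_ ?_).trans (hE.setLIntegral_inv_sq_le hT)).trans
      (by gcongr)
    · exact injOn_expSumMap hb (injOn_exp_periodStrip_zero.mono Set.inter_subset_left)
        fun z hz => (hR z.re hz.2).1.2
    · exact fun z hz => (norm_expSumMap_bounds (hR z.re hz.2).1.1 (hR z.re hz.2).1.2).1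
    · exact fun z hz => (norm_expSumMap_bounds (hR z.re hz.2).1.1 (hR z.re hz.2).1.2).2
  have hleft : volume ((periodStrip 0 ∩ {z | R ≤ (-z).re}) ∩ expSumMap a b ⁻¹' E) ≤
      1 / 4 * volume (E ∩ periodStrip 0) := by
    -- The left half reduces to the right one by `z ↦ -z`, which swaps `a` and `b`.
    have hbd : ∀ z ∈ periodStrip 0 ∩ {z : ℂ | R ≤ (-z).re}, T ≤ ‖expSumMap b a (-z)‖ ∧
        ‖expSumMap b a (-z)‖ ≤ 2 * ‖b * Complex.exp (-z) - a * Complex.exp (- -z)‖ :=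
      fun z hz => norm_expSumMap_bounds (hR (-z).re hz.2).2.1 (hR (-z).re hz.2).2.2
    refine ((volume_inter_preimage_le_setLIntegral hT (hasDerivAt_expSumMap a b)
      ((measurableSet_periodStrip 0).inter (measurableSet_le measurable_const
        (Complex.measurable_re.comp measurable_neg))) hEm ?_ ?_ ?_).trans (hE.setLIntegral_inv_sq_le hT)).trans
      (by gcongr)
    · have hinj : Set.InjOn (expSumMap b a) (Neg.neg '' (periodStrip 0 ∩ {z | R ≤ (-z).re})) := by
        refine injOn_expSumMap ha ?_ ?_
        · rintro _ ⟨z, hz, rfl⟩ _ ⟨w, hw, rfl⟩ h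
          rw [Complex.exp_neg, Complex.exp_neg, inv_inj] at h
          exact congrArg _ (injOn_exp_periodStrip_zero hz.1 hw.1 h)
        · rintro _ ⟨z, hz, rfl⟩
          exact (hR (-z).re hz.2).2.2
      intro z hz w hw h
      rw [← expSumMap_neg b a, ← expSumMap_neg b a] at h
      exact neg_injective (hinj (Set.mem_image_of_mem _ hz) (Set.mem_image_of_mem _ hw) h)
    · intro z hz
      rw [← expSumMap_neg]
      exact (hbd z hz).1
    · intro z hz
      rw [← expSumMap_neg, norm_sub_rev]
      simpa only [neg_neg] using (hbd z hz).2
  have hsub : ((centralStrip R)ᶜ ∩ expSumMap a b ⁻¹' E) ∩ periodStrip 0 ⊆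
      ((periodStrip 0 ∩ {z | R ≤ z.re}) ∩ expSumMap a b ⁻¹' E) ∪
      ((periodStrip 0 ∩ {z | R ≤ (-z).re}) ∩ expSumMap a b ⁻¹' E) := by
    rintro z ⟨⟨hzR, hzE⟩, hzS⟩
    have hzR' : R ≤ |z.re| := not_lt.1 hzR
    rcases le_abs.1 hzR' with h | h
    · exact Or.inl ⟨⟨hzS, h⟩, hzE⟩
    · exact Or.inr ⟨⟨hzS, h⟩, hzE⟩
  calc _ ≤ _ := (measure_mono hsub).trans (measure_union_le _ _)
    _ ≤ 1 / 4 * volume (E ∩ periodStrip 0) + 1 / 4 * volume (E ∩ periodStrip 0) :=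
      add_le_add hright hleft
    _ = 2⁻¹ * volume (E ∩ periodStrip 0) := by
      rw [← add_mul]
      congr 1
      rw [← ENNReal.toReal_eq_toReal_iff' (by simp) (by simp), ENNReal.toReal_add (by simp) (by simp)]
      norm_num

lemma volume_compl_escapingSet_expSumMap_lt_top {a b : ℂ} (ha : a ≠ 0) (hb : b ≠ 0) :
    volume ((escapingSet (expSumMap a b))ᶜ ∩ periodStrip 0) < ⊤ := by
  obtain ⟨R, hR⟩ := exists_volume_preimage_expSumMap_le ha hb
  exact volume_compl_escapingSet_inter_periodStrip_lt_top (continuous_expSumMap a b).measurable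
    (isPeriodicSet_preimage_expSumMap a b) hR

lemma volume_horizontalStrip_diff_escapingSet_lt_top {a b : ℂ} (ha : a ≠ 0) (hb : b ≠ 0)
    (α β : ℝ) : volume (horizontalStrip α β \ escapingSet (expSumMap a b)) < ⊤ := by
  rw [Set.sdiff_eq]
  exact (isPeriodicSet_compl_escapingSet
    (isPeriodicSet_preimage_expSumMap a b)).volume_inter_horizontalStrip_lt_top
      (volume_compl_escapingSet_expSumMap_lt_top ha hb) α β

lemma volume_escapingSet_expSumMap {a b : ℂ} (ha : a ≠ 0) (hb : b ≠ 0) :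
    volume (escapingSet (expSumMap a b)) = ⊤ := by
  by_contra h
  have hsub : periodStrip 0 ⊆ escapingSet (expSumMap a b) ∪
      ((escapingSet (expSumMap a b))ᶜ ∩ periodStrip 0) := fun z hz =>
    (em (z ∈ escapingSet (expSumMap a b))).imp id fun h' => ⟨h', hz⟩
  have hlt : volume (periodStrip 0) < ⊤ := (measure_mono hsub).trans_lt
    ((measure_union_le _ _).trans_lt (ENNReal.add_lt_top.2
      ⟨lt_top_iff_ne_top.2 h, volume_compl_escapingSet_expSumMap_lt_top ha hb⟩))
  exact hlt.ne volume_periodStrip_zero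

/-! ### Measurability and the sine map -/

lemma measurableSet_escapingSet {f : ℂ → ℂ} (hf : Measurable f) :
    MeasurableSet (escapingSet f) :=
  measurableSet_tendsto atTop fun n => (hf.iterate n).norm

lemma measurableSet_convergenceSet {f : ℂ → ℂ} (hf : Measurable f) (p : ℂ) :
    MeasurableSet (convergenceSet f p) :=
  measurableSet_tendsto (𝓝 p) fun n => hf.iterate n

/-- Iterates `i sin z = sinh (iz)`. -/
lemma I_mul_iterate_sin (n : ℕ) (z : ℂ) :
    Complex.I * Complex.sin^[n] z = (expSumMap (1 / 2) (-1 / 2))^[n] (Complex.I * z) := by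
  have h : Function.Semiconj (fun z => Complex.I * z) Complex.sin (expSumMap (1 / 2) (-1 / 2)) := by
    intro z
    simp only [expSumMap, Complex.sin]
    ring_nf
    simp
    ring
  exact (h.iterate_right n) z

lemma volume_verticalStrip_inter_convergenceSet_sin_lt_top (α β : ℝ) :
    volume (verticalStrip α β ∩ convergenceSet Complex.sin 0) < ⊤ := by
  have hmp : MeasurePreserving (fun z : ℂ => Complex.I * z) :=
    (rotation ⟨Complex.I, by simp [Submonoid.unitSphere]⟩).measurePreserving
  have hsub : verticalStrip α β ∩ convergenceSet Complex.sin 0 ⊆ (fun z : ℂ => Complex.I * z) ⁻¹'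
      (horizontalStrip α β \ escapingSet (expSumMap (1 / 2) (-1 / 2))) := by
    rintro z ⟨hz, hconv⟩
    refine ⟨by simpa [horizontalStrip, verticalStrip] using hz, fun hesc => ?_⟩
    have hesc' : Tendsto (fun n => ‖(expSumMap (1 / 2) (-1 / 2))^[n] (Complex.I * z)‖) atTop atTop :=
      hesc
    simp only [← I_mul_iterate_sin, norm_mul, Complex.norm_I, one_mul] at hesc'
    have hconv' : Tendsto (fun n => Complex.sin^[n] z) atTop (𝓝 0) := hconv
    exact not_tendsto_nhds_of_tendsto_atTop hesc' _ hconv'.norm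
  refine (measure_mono hsub).trans_lt ?_
  refine (hmp.measure_preimage_le _).trans_lt ?_
  exact volume_horizontalStrip_diff_escapingSet_lt_top (by norm_num) (by norm_num) α β

theorem mainTheorem9 :
    (∀ a b : ℂ, a * b ≠ 0 →
      MeasurableSet (escapingSet (expSumMap a b)) ∧
      volume (escapingSet (expSumMap a b)) = ⊤ ∧
      ∀ α β : ℝ, volume (horizontalStrip α β \ escapingSet (expSumMap a b)) < ⊤) ∧
    (MeasurableSet (convergenceSet Complex.sin 0) ∧
      ∀ α β : ℝ, volume (verticalStrip α β ∩ convergenceSet Complex.sin 0) < ⊤) := by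
  refine ⟨fun a b hab => ?_, measurableSet_convergenceSet Complex.measurable_sin 0,
    volume_verticalStrip_inter_convergenceSet_sin_lt_top⟩
  obtain ⟨ha, hb⟩ := mul_ne_zero_iff.1 hab
  exact ⟨measurableSet_escapingSet (continuous_expSumMap a b).measurable,
    volume_escapingSet_expSumMap ha hb, volume_horizontalStrip_diff_escapingSet_lt_top ha hb⟩
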